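/- Let $T:\mathbb{R}^m\to\mathbb{R}^k$ be a random linear map of the form $T(x)=\sqrt{1/k}\,Px$, where the random $k\times m$ matrix $P$ is of one of the following four kinds: (i) $P$ is the orthogonal projection onto a uniformly distributed random $k$-dimensional linear subspace of $\mathbb{R}^m$, written in an orthonormal basis of that subspace (here $k\le m$); (ii) the entries of $P$ are independent standard normal variables; (iii) the entries of $P$ are independent and take the values $+1$ and $-1$, each with probability $\frac12$; (iv) the entries of $P$ are independent and take the values $+1,0,-1$ with probabilities $\frac16,\frac23,\frac16$ respectively. There is a universal constant $\mathcal{C}>0$ (independent of $m,n,k$, of $\varepsilon$, of the points below and of the kind of $P$) such that the following holds. Let $n\ge 1$, let $a_1,\dots,a_n\in\mathbb{R}^m$, let $C=\mathrm{conv}\{a_1,\dots,a_n\}$, and let $b\in\mathbb{R}^m$ with $b\notin C$. Put $d=\min_{x\in C}\|b-x\|$ and $D=\max_{1\le i\le n}\|b-a_i\|$ (Euclidean norm). Then for every $\varepsilon$ with $0<\varepsilon<\frac{d^2}{D^2}$, $$\mathrm{Prob}\big[T(b)\notin T(C)\big]\;\ge\;1-2n^2e^{-\mathcal{C}(\varepsilon^2-\varepsilon^3)k}.$$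 -/

import Mathlib

open MeasureTheory ProbabilityTheory
open scoped ENNReal

namespace RandomProjection

noncomputable section

/-- The uniform distribution on `{-1, 1}`. -/
def signLaw : Measure ℝ :=
  (1 / 2 : ℝ≥0∞) • Measure.dirac 1 + (1 / 2 : ℝ≥0∞) • Measure.dirac (-1)

/-- The distribution taking the values `1, 0, -1` with probabilities `1/6, 2/3, 1/6`. -/
def sparseSignLaw : Measure ℝ :=
  (1 / 6 : ℝ≥0∞) • Measure.dirac 1 + (2 / 3 : ℝ≥0∞) • Measure.dirac 0 +
    (1 / 6 : ℝ≥0∞) • Measure.dirac (-1)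

variable {Ω : Type*} [MeasurableSpace Ω]

/-- The entries of the random `k × m` matrix `P` are independent, each with law `ν`. -/
structure HasIIDEntries (μ : Measure Ω) {k m : ℕ}
    (P : Ω → Matrix (Fin k) (Fin m) ℝ) (ν : Measure ℝ) : Prop where
  entry_law : ∀ i j, HasLaw (fun ω => P ω i j) ν μ
  indep : iIndepFun (fun (p : Fin k × Fin m) ω => P ω p.1 p.2) μ

/-- `P` is the orthogonal projection of `ℝ^m` onto a uniformly distributed random `k`-dimensional
linear subspace `V`, written in some orthonormal basis of `V`. The rows of `P ω` are that
orthonormal basis (so `V ω` is the row space of `P ω`); the `m × m` matrix `(P ω)ᵀ * P ω` is the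
orthogonal projector onto `V ω`; and `V` is uniformly distributed, that is, its law on the
Grassmannian is invariant under every orthogonal map `Q`: replacing `V` by `Q V` replaces the
projector by `Q * ((P ω)ᵀ * P ω) * Qᵀ`. -/
structure IsRandomOrthogonalProjection (μ : Measure Ω) {k m : ℕ}
    (P : Ω → Matrix (Fin k) (Fin m) ℝ) : Prop where
  aemeasurable_entry : ∀ i j, AEMeasurable (fun ω => P ω i j) μ
  orthonormal_rows : ∀ᵐ ω ∂μ, P ω * (P ω).transpose = 1
  uniform : ∀ Q ∈ Matrix.orthogonalGroup (Fin m) ℝ,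
    IdentDistrib
      (fun ω (p : Fin m × Fin m) => (Q * ((P ω).transpose * P ω) * Q.transpose) p.1 p.2)
      (fun ω (p : Fin m × Fin m) => ((P ω).transpose * P ω) p.1 p.2) μ μ

/-- The four kinds of random matrices from which a random projection is built. -/
inductive IsProjectionMatrix (μ : Measure Ω) {k m : ℕ}
    (P : Ω → Matrix (Fin k) (Fin m) ℝ) : Prop
  | orthogonal (h : IsRandomOrthogonalProjection μ P)
  | gaussian (h : HasIIDEntries μ P (gaussianReal 0 1))
  | sign (h : HasIIDEntries μ P signLaw)
  | sparseSign (h : HasIIDEntries μ P sparseSignLaw)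

/-- The linear map `x ↦ √(1/k) P x` between Euclidean spaces. -/
def scaledMap {k m : ℕ} (P : Matrix (Fin k) (Fin m) ℝ) :
    EuclideanSpace ℝ (Fin m) →ₗ[ℝ] EuclideanSpace ℝ (Fin k) :=
  √(1 / (k : ℝ)) • Matrix.toEuclideanLin P

end

end RandomProjection

/-! Let q be the point of C nearest to b and put w = q - b. Minimality gives ⟨x - b, w⟩ ≥ d² for all
x in C. If each ⟨P(a_i - b), Pw⟩ is still positive, a half-space separates Pb from P(C); so only n
signs have to survive the projection.

Each angle between a_i - b and w has cosine greater than ε. For unit vectors u, w, polarization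
writes 4⟨Pu, Pw⟩ as ‖P(u + w)‖² - ‖P(u - w)‖², so the sign survives once these two squared norms are
distorted by a relative error of at most ε. The needed tails are packaged in `NormConcentrates`,
whose scale s is immaterial to signs.

For independent entries, the coordinates of Pu are independent and sub-Gaussian, and a Chernoff
bound controls the sum of their squares. For a random subspace, rotation invariance allows the fixed
vector to be replaced by an independent Gaussian g (`le_of_sections`). For fixed P, the vector Pg is
standard Gaussian in ℝ^k, so ‖Pg‖² and ‖g‖² concentrate near k and m.

A union bound over the a_i finishes the proof; halving the rate absorbs the extra constant. -/

namespace RandomProjection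

/-! ### Chernoff bounds for sums of squares of sub-Gaussian variables -/

section Tails

lemma exp_le_one_add_add_sq_mul_exp_abs (z : ℝ) :
    Real.exp z ≤ 1 + z + z ^ 2 * Real.exp |z| := by
  have h1 : 1 ≤ Real.exp |z| := Real.one_le_exp (abs_nonneg z)
  have h2 : z ^ 2 ≤ z ^ 2 * Real.exp |z| := le_mul_of_one_le_right (sq_nonneg z) h1
  rcases le_or_gt |z| 1 with h | h
  · have := (abs_le.mp (Real.abs_exp_sub_one_sub_id_le h)).2
    linarith
  · rcases lt_abs.mp h with h | h
    · rw [abs_of_pos (by linarith)]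
      have : Real.exp z ≤ z ^ 2 * Real.exp z :=
        le_mul_of_one_le_left (Real.exp_pos z).le (by nlinarith)
      linarith
    · have : Real.exp z ≤ 1 := Real.exp_le_one_iff.mpr (by linarith)
      nlinarith

lemma lintegral_exp_sq_div_four_gaussianReal :
    ∫⁻ y, ENNReal.ofReal (Real.exp (y ^ 2 / 4)) ∂(gaussianReal 0 1) ≤ 2 := by
  have hpt : ∀ y : ℝ, gaussianPDF 0 1 y * ENNReal.ofReal (Real.exp (y ^ 2 / 4)) =
      ENNReal.ofReal ((√(2 * Real.pi))⁻¹ * Real.exp (-(1 / 4) * y ^ 2)) := by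
    intro y
    rw [gaussianPDF, ← ENNReal.ofReal_mul (gaussianPDFReal_nonneg _ _ _), gaussianPDFReal,
      mul_assoc, ← Real.exp_add]
    congr 2
    · simp
    · congr 1
      simp
      ring
  rw [gaussianReal_of_var_ne_zero _ one_ne_zero,
    lintegral_withDensity_eq_lintegral_mul₀ (measurable_gaussianPDF 0 1).aemeasurable
      (by fun_prop)]
  simp only [Pi.mul_apply, hpt]
  rw [← ofReal_integral_eq_lintegral_ofReal
    ((integrable_exp_neg_mul_sq (by norm_num)).const_mul _) (ae_of_all _ fun y => by positivity),
    integral_const_mul, integral_gaussian, ← Real.sqrt_inv, ← Real.sqrt_mul (by positivity)]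
  have : √((2 * Real.pi)⁻¹ * (Real.pi / (1 / 4))) ≤ 2 := by
    rw [Real.sqrt_le_left (by norm_num)]
    field_simp
    norm_num
  exact (ENNReal.ofReal_le_ofReal this).trans (by simp)

lemma lintegral_exp_mul_gaussianReal (t : ℝ) :
    ∫⁻ y, ENNReal.ofReal (Real.exp (t * y)) ∂(gaussianReal 0 1) =
      ENNReal.ofReal (Real.exp (t ^ 2 / 2)) := by
  rw [← ofReal_integral_eq_lintegral_ofReal (integrable_exp_mul_gaussianReal t)
    (ae_of_all _ fun y => by positivity)]
  have := congrFun (mgf_fun_id_gaussianReal (μ := 0) (v := 1)) t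
  rw [mgf] at this
  rw [this]
  simp

variable {Ω : Type*} [MeasurableSpace Ω] {μ : Measure Ω} [IsProbabilityMeasure μ]

/-- Linearize the square with an independent standard Gaussian g: exp(Y²/4) is the g-average of
exp(Yg/√2). Integrating over Y first leaves at most exp(g²/4), whose mean is √2. -/
lemma lintegral_exp_sq_div_four_le {Y : Ω → ℝ} (h : HasSubgaussianMGF Y 1 μ) :
    ∫⁻ ω, ENNReal.ofReal (Real.exp (Y ω ^ 2 / 4)) ∂μ ≤ 2 := by
  have hY := h.aemeasurable
  have hs : √(1 / 2 : ℝ) ^ 2 = 1 / 2 := Real.sq_sqrt (by norm_num)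
  calc ∫⁻ ω, ENNReal.ofReal (Real.exp (Y ω ^ 2 / 4)) ∂μ
      = ∫⁻ ω, ∫⁻ y, ENNReal.ofReal (Real.exp (√(1 / 2) * Y ω * y)) ∂(gaussianReal 0 1) ∂μ := by
        congr with ω
        rw [lintegral_exp_mul_gaussianReal, mul_pow, hs]
        ring_nf
    _ = ∫⁻ y, ∫⁻ ω, ENNReal.ofReal (Real.exp (√(1 / 2) * Y ω * y)) ∂μ ∂(gaussianReal 0 1) := by
        refine lintegral_lintegral_swap ?_
        have : AEMeasurable (fun p : Ω × ℝ => Y p.1) (μ.prod (gaussianReal 0 1)) := hY.comp_fst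
        unfold Function.uncurry
        fun_prop
    _ ≤ ∫⁻ y, ENNReal.ofReal (Real.exp (y ^ 2 / 4)) ∂(gaussianReal 0 1) := by
        refine lintegral_mono fun y => ?_
        have hi := h.integrable_exp_mul (√(1 / 2) * y)
        have hm := h.mgf_le (√(1 / 2) * y)
        have he : ∀ ω, √(1 / 2) * Y ω * y = √(1 / 2) * y * Y ω := fun ω => by ring
        simp only [he]
        rw [← ofReal_integral_eq_lintegral_ofReal hi (ae_of_all _ fun y => by positivity)]
        refine ENNReal.ofReal_le_ofReal (hm.trans (le_of_eq ?_))
        rw [mul_pow, hs]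
        congr 1
        push_cast
        ring
    _ ≤ 2 := lintegral_exp_sq_div_four_gaussianReal

lemma integrable_exp_sq_div_four {Y : Ω → ℝ} (h : HasSubgaussianMGF Y 1 μ) :
    Integrable (fun ω => Real.exp (Y ω ^ 2 / 4)) μ := by
  have hY := h.aemeasurable
  refine (lintegral_ofReal_ne_top_iff_integrable
    (by fun_prop) (ae_of_all _ fun y => by positivity)).mp ?_
  exact ne_top_of_le_ne_top (by simp) (lintegral_exp_sq_div_four_le h)

lemma integral_exp_sq_div_four_le {Y : Ω → ℝ} (h : HasSubgaussianMGF Y 1 μ) :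
    ∫ ω, Real.exp (Y ω ^ 2 / 4) ∂μ ≤ 2 := by
  have h1 := lintegral_exp_sq_div_four_le h
  rw [← ofReal_integral_eq_lintegral_ofReal (integrable_exp_sq_div_four h)
    (ae_of_all _ fun y => by positivity)] at h1
  rw [← ENNReal.ofReal_ofNat 2] at h1
  exact (ENNReal.ofReal_le_ofReal_iff (by norm_num)).mp h1

/-- Second-order Taylor bound for z = y² - v. Both z² and exp|tz| are controlled by exp(|z|/16), and
the product exp(|z|/8) is at most exp(1/8 + y²/4). The linear term has mean zero when v is the
second moment. -/
lemma exp_mul_sq_sub_le {t v : ℝ} (ht : |t| ≤ 1 / 16) (hv0 : 0 ≤ v) (hv1 : v ≤ 1) (y : ℝ) :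
    Real.exp (t * (y ^ 2 - v)) ≤
      1 + t * (y ^ 2 - v) + 1024 * t ^ 2 * Real.exp (y ^ 2 / 4) := by
  set z := y ^ 2 - v with hz
  have hzabs : |z| ≤ y ^ 2 + 1 := abs_le.mpr ⟨by nlinarith [sq_nonneg y], by nlinarith⟩
  have h1 := exp_le_one_add_add_sq_mul_exp_abs (t * z)
  have h2 : Real.exp |t * z| ≤ Real.exp (|z| / 16) := by
    rw [abs_mul]
    gcongr
    nlinarith [abs_nonneg z]
  have h3 : z ^ 2 ≤ 512 * Real.exp (|z| / 16) := by
    have := Real.quadratic_le_exp_of_nonneg (x := |z| / 16) (by positivity)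
    nlinarith [sq_abs z, abs_nonneg z]
  have h4 : Real.exp (|z| / 16) * Real.exp (|z| / 16) ≤ 2 * Real.exp (y ^ 2 / 4) := by
    have h5 : Real.exp (1 / 8) ≤ 2 := by
      have := Real.exp_one_lt_d9
      have h6 : Real.exp (1 / 8) ^ 8 = Real.exp 1 := by rw [← Real.exp_nat_mul]; norm_num
      by_contra! h7
      have : (2 : ℝ) ^ 8 < Real.exp (1 / 8) ^ 8 := by gcongr
      norm_num at *
      linarith
    calc Real.exp (|z| / 16) * Real.exp (|z| / 16) = Real.exp (|z| / 8) := by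
          rw [← Real.exp_add]; ring_nf
      _ ≤ Real.exp (1 / 8 + y ^ 2 / 4) := by gcongr; nlinarith [sq_nonneg y]
      _ ≤ 2 * Real.exp (y ^ 2 / 4) := by rw [Real.exp_add]; gcongr
  have h5 : (t * z) ^ 2 * Real.exp |t * z| ≤ 1024 * t ^ 2 * Real.exp (y ^ 2 / 4) := by
    calc (t * z) ^ 2 * Real.exp |t * z|
        ≤ (t ^ 2 * (512 * Real.exp (|z| / 16))) * Real.exp (|z| / 16) := by
          rw [mul_pow]; gcongr
      _ = 512 * t ^ 2 * (Real.exp (|z| / 16) * Real.exp (|z| / 16)) := by ring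
      _ ≤ 512 * t ^ 2 * (2 * Real.exp (y ^ 2 / 4)) := by gcongr
      _ = _ := by ring
  linarith

lemma integrable_exp_mul_sq_sub {Y : Ω → ℝ} (h : HasSubgaussianMGF Y 1 μ) {t v : ℝ}
    (ht : |t| ≤ 1 / 16) (hv0 : 0 ≤ v) (hv1 : v ≤ 1) :
    Integrable (fun ω => Real.exp (t * (Y ω ^ 2 - v))) μ := by
  have hY := h.aemeasurable
  have hsq : Integrable (fun ω => Y ω ^ 2) μ := (h.memLp 2).integrable_sq
  refine Integrable.mono' (((integrable_const 1).add ((hsq.sub (integrable_const v)).const_mul t)).add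
    ((integrable_exp_sq_div_four h).const_mul (1024 * t ^ 2))) (by fun_prop)
    (ae_of_all _ fun ω => ?_)
  rw [Real.norm_of_nonneg (by positivity)]
  exact exp_mul_sq_sub_le ht hv0 hv1 (Y ω)

lemma mgf_sq_sub_le {Y : Ω → ℝ} (h : HasSubgaussianMGF Y 1 μ) {t v : ℝ}
    (ht : |t| ≤ 1 / 16) (hv0 : 0 ≤ v) (hv1 : v ≤ 1) (hv : ∫ ω, Y ω ^ 2 ∂μ = v) :
    mgf (fun ω => Y ω ^ 2 - v) μ t ≤ Real.exp (2048 * t ^ 2) := by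
  have hsq : Integrable (fun ω => Y ω ^ 2) μ := (h.memLp 2).integrable_sq
  have hlin : Integrable (fun ω => t * (Y ω ^ 2 - v)) μ :=
    (hsq.sub (integrable_const v)).const_mul t
  have hexp := (integrable_exp_sq_div_four h).const_mul (1024 * t ^ 2)
  have h1 : Integrable (fun ω => 1 + t * (Y ω ^ 2 - v)) μ := (integrable_const 1).add hlin
  calc mgf (fun ω => Y ω ^ 2 - v) μ t
      ≤ ∫ ω, (1 + t * (Y ω ^ 2 - v) + 1024 * t ^ 2 * Real.exp (Y ω ^ 2 / 4)) ∂μ :=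
        integral_mono (integrable_exp_mul_sq_sub h ht hv0 hv1) (h1.add hexp)
          fun ω => exp_mul_sq_sub_le ht hv0 hv1 (Y ω)
    _ = 1 + 1024 * t ^ 2 * ∫ ω, Real.exp (Y ω ^ 2 / 4) ∂μ := by
        rw [integral_add h1 hexp, integral_add (integrable_const 1) hlin, integral_const_mul,
          integral_const_mul, integral_sub hsq (integrable_const v), hv]
        simp
    _ ≤ 1 + 1024 * t ^ 2 * 2 := by
        gcongr
        exact integral_exp_sq_div_four_le h
    _ ≤ Real.exp (2048 * t ^ 2) := by
        have := Real.add_one_le_exp (2048 * t ^ 2)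
        linarith

variable {k : ℕ} {Y : Fin k → Ω → ℝ} {v : ℝ}

lemma mgf_sum_sq_sub_le (hind : iIndepFun Y μ) (hY : ∀ i, HasSubgaussianMGF (Y i) 1 μ) {t : ℝ}
    (ht : |t| ≤ 1 / 16) (hv0 : 0 ≤ v) (hv1 : v ≤ 1) (hv : ∀ i, ∫ ω, Y i ω ^ 2 ∂μ = v) :
    Integrable (fun ω => Real.exp (t * ∑ i, (Y i ω ^ 2 - v))) μ ∧
      mgf (fun ω => ∑ i, (Y i ω ^ 2 - v)) μ t ≤ Real.exp (2048 * t ^ 2 * k) := by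
  have hind' : iIndepFun (fun i ω => Y i ω ^ 2 - v) μ :=
    hind.comp (fun _ y => y ^ 2 - v) fun _ => by fun_prop
  have hm : ∀ i, AEMeasurable (fun ω => Y i ω ^ 2 - v) μ := fun i => by
    have := (hY i).aemeasurable
    fun_prop
  have hsum : (fun ω => ∑ i, (Y i ω ^ 2 - v)) = ∑ i, fun ω => Y i ω ^ 2 - v := by
    ext ω; simp
  have hmgf := hind'.mgf_sum₀ (t := t) hm Finset.univ
  rw [← hsum] at hmgf
  constructor
  -- A non-integrable exponential would have `mgf` equal to the default value 0, but the product of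
  -- the coordinate mgfs is positive.
  · by_contra hcon
    have h0 : mgf (fun ω => ∑ i, (Y i ω ^ 2 - v)) μ t = 0 := integral_undef hcon
    rw [h0] at hmgf
    refine (Finset.prod_pos fun i _ => ?_ : (0 : ℝ) < ∏ i, mgf (fun ω => Y i ω ^ 2 - v) μ t).ne hmgf
    exact mgf_pos (integrable_exp_mul_sq_sub (hY i) ht hv0 hv1)
  · rw [hmgf]
    calc _ ≤ ∏ _i : Fin k, Real.exp (2048 * t ^ 2) :=
          Finset.prod_le_prod (fun i _ => mgf_nonneg)
            fun i _ => mgf_sq_sub_le (hY i) ht hv0 hv1 (hv i)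
      _ = _ := by
          rw [Finset.prod_const, ← Real.exp_nat_mul]
          simp
          ring

/-- Upper tail of the squared norm of a vector with independent sub-Gaussian coordinates. -/
lemma measureReal_sum_sq_ge_le (hind : iIndepFun Y μ) (hY : ∀ i, HasSubgaussianMGF (Y i) 1 μ)
    (hv0 : 1 / 3 ≤ v) (hv1 : v ≤ 1) (hv : ∀ i, ∫ ω, Y i ω ^ 2 ∂μ = v) {ε : ℝ}
    (hε0 : 0 ≤ ε) (hε1 : ε ≤ 1) :
    μ.real {ω | (1 + ε) * (v * k) ≤ ∑ i, Y i ω ^ 2} ≤ Real.exp (-(ε ^ 2 * k / 73728)) := by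
  -- This t minimizes -tε/3 + 2048t², with v replaced by its lower bound 1/3; the minimum is
  -- -ε²/73728.
  obtain ⟨hint, hle⟩ := mgf_sum_sq_sub_le hind hY (t := ε / 12288)
    (by rw [abs_of_nonneg (by positivity)]; linarith) (by linarith) hv1 hv
  have h := measure_ge_le_exp_mul_mgf (ε * (v * k)) (by positivity) hint
  have hset : {ω | (1 + ε) * (v * k) ≤ ∑ i, Y i ω ^ 2} =
      {ω | ε * (v * k) ≤ ∑ i, (Y i ω ^ 2 - v)} := by
    ext ω
    simp only [Set.mem_ofPred_eq, Finset.sum_sub_distrib, Finset.sum_const, Finset.card_univ,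
      Fintype.card_fin, nsmul_eq_mul]
    constructor <;> intro h <;> linarith
  rw [hset]
  refine h.trans ((mul_le_mul_of_nonneg_left hle (Real.exp_pos _).le).trans ?_)
  rw [← Real.exp_add]
  gcongr
  have : 1 / 3 * (ε ^ 2 * k) ≤ v * (ε ^ 2 * k) := by gcongr
  linarith

/-- Lower tail of the squared norm of a vector with independent sub-Gaussian coordinates. -/
lemma measureReal_sum_sq_le_le (hind : iIndepFun Y μ) (hY : ∀ i, HasSubgaussianMGF (Y i) 1 μ)
    (hv0 : 1 / 3 ≤ v) (hv1 : v ≤ 1) (hv : ∀ i, ∫ ω, Y i ω ^ 2 ∂μ = v) {ε : ℝ}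
    (hε0 : 0 ≤ ε) (hε1 : ε ≤ 1) :
    μ.real {ω | ∑ i, Y i ω ^ 2 ≤ (1 - ε) * (v * k)} ≤ Real.exp (-(ε ^ 2 * k / 73728)) := by
  obtain ⟨hint, hle⟩ := mgf_sum_sq_sub_le hind hY (t := -(ε / 12288))
    (by rw [abs_neg, abs_of_nonneg (by positivity)]; linarith) (by linarith) hv1 hv
  have h := measure_le_le_exp_mul_mgf (-(ε * (v * k))) (by rw [neg_nonpos]; positivity) hint
  have hset : {ω | ∑ i, Y i ω ^ 2 ≤ (1 - ε) * (v * k)} =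
      {ω | ∑ i, (Y i ω ^ 2 - v) ≤ -(ε * (v * k))} := by
    ext ω
    simp only [Set.mem_ofPred_eq, Finset.sum_sub_distrib, Finset.sum_const, Finset.card_univ,
      Fintype.card_fin, nsmul_eq_mul]
    constructor <;> intro h <;> linarith
  rw [hset]
  refine h.trans ((mul_le_mul_of_nonneg_left hle (Real.exp_pos _).le).trans ?_)
  rw [← Real.exp_add]
  gcongr
  have : 1 / 3 * (ε ^ 2 * k) ≤ v * (ε ^ 2 * k) := by gcongr
  linarith

end Tails

/-! ### Linear forms in independent entries, and the entry laws -/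

section Entries

section LinearForms

open Matrix

variable {Ω : Type*} [MeasurableSpace Ω] {μ : Measure Ω} [IsProbabilityMeasure μ]
  {m : ℕ} {X : Fin m → Ω → ℝ} {v : ℝ}

lemma covariance_linearForm (hind : iIndepFun X μ) (hX : ∀ j, MemLp (X j) 2 μ)
    (h0 : ∀ j, ∫ ω, X j ω ∂μ = 0) (hv : ∀ j, ∫ ω, X j ω ^ 2 ∂μ = v) (a b : Fin m → ℝ) :
    cov[fun ω => ∑ j, a j * X j ω, fun ω => ∑ j, b j * X j ω; μ] = v * (a ⬝ᵥ b) := by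
  classical
  rw [covariance_fun_sum_fun_sum (fun j => (hX j).const_mul _) (fun j => (hX j).const_mul _)]
  simp only [covariance_const_mul_left, covariance_const_mul_right]
  have hc : ∀ i j, cov[X i, X j; μ] = if i = j then v else 0 := by
    intro i j
    split_ifs with h
    · subst h
      rw [covariance_self (hX i).aemeasurable,
        variance_of_integral_eq_zero (hX i).aemeasurable (h0 i), hv]
    · exact (hind.indepFun h).covariance_eq_zero (hX i) (hX j)
  simp only [hc, mul_ite, mul_zero, Finset.sum_ite_eq, Finset.mem_univ, if_true, dotProduct,
    Finset.mul_sum]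
  exact Finset.sum_congr rfl fun i _ => by ring

omit [IsProbabilityMeasure μ] in
lemma integral_linearForm (hX : ∀ j, Integrable (X j) μ)
    (h0 : ∀ j, ∫ ω, X j ω ∂μ = 0) (a : Fin m → ℝ) : ∫ ω, ∑ j, a j * X j ω ∂μ = 0 := by
  rw [integral_finsetSum _ fun j _ => (hX j).const_mul _]
  simp [integral_const_mul, h0]

lemma integral_linearForm_sq (hind : iIndepFun X μ) (hX : ∀ j, MemLp (X j) 2 μ)
    (h0 : ∀ j, ∫ ω, X j ω ∂μ = 0) (hv : ∀ j, ∫ ω, X j ω ^ 2 ∂μ = v) (a : Fin m → ℝ) :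
    ∫ ω, (∑ j, a j * X j ω) ^ 2 ∂μ = v * (a ⬝ᵥ a) := by
  have hm : AEMeasurable (fun ω => ∑ j, a j * X j ω) μ :=
    Finset.aemeasurable_fun_sum _ fun j _ => (hX j).aemeasurable.const_mul _
  rw [← variance_of_integral_eq_zero hm
    (integral_linearForm (fun j => (hX j).integrable one_le_two) h0 a), ← covariance_self hm,
    covariance_linearForm hind hX h0 hv]

omit [IsProbabilityMeasure μ] in
lemma hasSubgaussianMGF_linearForm (hind : iIndepFun X μ)
    (hX : ∀ j, HasSubgaussianMGF (X j) 1 μ) {a : Fin m → ℝ} (ha : a ⬝ᵥ a = 1) :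
    HasSubgaussianMGF (fun ω => ∑ j, a j * X j ω) 1 μ := by
  have h := HasSubgaussianMGF.sum_of_iIndepFun (s := Finset.univ)
    (hind.comp (fun j y => a j * y) fun j => by fun_prop)
    (fun j _ => (hX j).const_mul (a j))
  have hc : ∑ j, (⟨a j ^ 2, sq_nonneg (a j)⟩ * 1 : NNReal) = 1 := by
    apply NNReal.eq
    rw [NNReal.coe_sum, NNReal.coe_one, ← ha]
    exact Finset.sum_congr rfl fun j _ => (mul_one _).trans (pow_two _)
  rw [hc] at h
  exact h

end LinearForms

section Laws

lemma hasSubgaussianMGF_id_gaussianReal :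
    HasSubgaussianMGF id 1 (gaussianReal 0 1) where
  integrable_exp_mul t := integrable_exp_mul_gaussianReal t
  mgf_le t := by
    rw [mgf_id_gaussianReal]
    simp

lemma integral_sq_gaussianReal : ∫ x, x ^ 2 ∂(gaussianReal 0 1) = 1 := by
  have h := variance_of_integral_eq_zero (μ := gaussianReal 0 1) (X := fun x => x)
    aemeasurable_id (by simp)
  rw [← h]
  simp [variance_fun_id_gaussianReal]

instance : IsProbabilityMeasure signLaw where
  measure_univ := by
    simp [signLaw, ENNReal.inv_two_add_inv_two]

lemma integrable_signLaw (f : ℝ → ℝ) : Integrable f signLaw :=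
  ((integrable_dirac (by simp)).smul_measure (by simp)).add_measure
    ((integrable_dirac (by simp)).smul_measure (by simp))

lemma integral_signLaw (f : ℝ → ℝ) : ∫ x, f x ∂signLaw = (f 1 + f (-1)) / 2 := by
  rw [signLaw, integral_add_measure
    ((integrable_dirac (by simp)).smul_measure (by simp))
    ((integrable_dirac (by simp)).smul_measure (by simp))]
  simp
  ring

lemma hasSubgaussianMGF_id_signLaw : HasSubgaussianMGF id 1 signLaw where
  integrable_exp_mul t := integrable_signLaw _
  mgf_le t := by
    rw [mgf, integral_signLaw]
    have := Real.cosh_le_exp_half_sq t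
    rw [Real.cosh_eq] at this
    simpa using this

instance : IsProbabilityMeasure sparseSignLaw where
  measure_univ := by
    simp only [sparseSignLaw, Measure.coe_add, Measure.coe_smul, Pi.add_apply, Pi.smul_apply,
      measure_univ, smul_eq_mul, mul_one]
    rw [← ENNReal.toReal_eq_one_iff]
    rw [ENNReal.toReal_add (by simp [ENNReal.div_eq_top]) (by simp),
      ENNReal.toReal_add (by simp) (by simp [ENNReal.div_eq_top])]
    simp
    norm_num

lemma integrable_sparseSignLaw (f : ℝ → ℝ) : Integrable f sparseSignLaw :=
  (((integrable_dirac (by simp)).smul_measure (by simp)).add_measure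
    ((integrable_dirac (by simp)).smul_measure (by simp [ENNReal.div_eq_top]))).add_measure
    ((integrable_dirac (by simp)).smul_measure (by simp))

lemma integral_sparseSignLaw (f : ℝ → ℝ) :
    ∫ x, f x ∂sparseSignLaw = (f 1 + 4 * f 0 + f (-1)) / 6 := by
  have h : ∀ x, ∀ c : ℝ≥0∞, c ≠ ∞ → Integrable f (c • Measure.dirac x) := fun x c hc =>
    (integrable_dirac (by simp)).smul_measure hc
  have h1 := h 1 (1 / 6) (by simp)
  have h2 := h 0 (2 / 3) (by simp [ENNReal.div_eq_top])
  have h3 := h (-1) (1 / 6) (by simp)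
  rw [sparseSignLaw, integral_add_measure (h1.add_measure h2) h3, integral_add_measure h1 h2]
  simp
  ring

/-- The mgf is (cosh t + 2)/3, an average of two quantities bounded by exp(t²/2). -/
lemma hasSubgaussianMGF_id_sparseSignLaw : HasSubgaussianMGF id 1 sparseSignLaw where
  integrable_exp_mul t := integrable_sparseSignLaw _
  mgf_le t := by
    rw [mgf, integral_sparseSignLaw]
    have h1 := Real.cosh_le_exp_half_sq t
    have h2 : 1 ≤ Real.exp (t ^ 2 / 2) := Real.one_le_exp (by positivity)
    rw [Real.cosh_eq] at h1
    simp
    linarith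

end Laws

section Rows

variable {Ω : Type*} [MeasurableSpace Ω] {μ : Measure Ω} [IsProbabilityMeasure μ] {k m : ℕ}
  {P : Ω → Matrix (Fin k) (Fin m) ℝ} {ν : Measure ℝ} [IsProbabilityMeasure ν]

/-- The joint law of the entries is a product over pairs (i, j); currying turns it into a product
over i of row laws. -/
lemma HasIIDEntries.iIndepFun_rows (h : HasIIDEntries μ P ν) :
    iIndepFun (fun i ω => P ω i) μ := by
  have hm : ∀ i j, AEMeasurable (fun ω => P ω i j) μ := fun i j => (h.entry_law i j).aemeasurable
  have hrow : ∀ i, AEMeasurable (fun ω => P ω i) μ := fun i => aemeasurable_pi_iff.mpr (hm i)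
  rw [iIndepFun_iff_map_fun_eq_pi_map hrow]
  have hall : HasLaw (fun ω (p : Fin k × Fin m) => P ω p.1 p.2) (Measure.pi fun _ => ν) μ :=
    h.indep.hasLaw_pi fun p => h.entry_law p.1 p.2
  have hi : ∀ i, μ.map (fun ω => P ω i) = Measure.pi fun _ => ν := fun i =>
    ((h.indep.precomp (g := fun j => (i, j)) fun _ _ hj => (Prod.ext_iff.mp hj).2).hasLaw_pi
      fun j => h.entry_law i j).map_eq
  simp only [hi]
  have hcurry := Measure.infinitePi_map_curry (ι := Fin k) (κ := Fin m) (fun _ _ => ν)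
  simp only [Measure.infinitePi_eq_pi] at hcurry
  rw [← hcurry, ← hall.map_eq, AEMeasurable.map_map_of_aemeasurable (by fun_prop)
    hall.aemeasurable]
  rfl

omit [IsProbabilityMeasure μ] [IsProbabilityMeasure ν] in
lemma HasIIDEntries.hasSubgaussianMGF (h : HasIIDEntries μ P ν)
    (hν : HasSubgaussianMGF id 1 ν) (i : Fin k) (j : Fin m) :
    HasSubgaussianMGF (fun ω => P ω i j) 1 μ := by
  have h1 := (h.entry_law i j).map_eq
  refine HasSubgaussianMGF.of_map (X := id) (h.entry_law i j).aemeasurable ?_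
  rw [h1]
  exact hν

end Rows

end Entries

open Matrix

/-! ### Norm concentration for independent entries -/

section Concentration

/-- The squared norms `‖P x‖ ^ 2` are concentrated around `s * ‖x‖ ^ 2`, with sub-Gaussian tails
of rate `c * k`. -/
structure NormConcentrates {Ω : Type*} [MeasurableSpace Ω] (μ : Measure Ω) {k m : ℕ}
    (P : Ω → Matrix (Fin k) (Fin m) ℝ) (s c : ℝ) : Prop where
  lower : ∀ x : Fin m → ℝ, x ≠ 0 → ∀ ε : ℝ, 0 ≤ ε → ε ≤ 1 →
    μ.real {ω | (P ω *ᵥ x) ⬝ᵥ (P ω *ᵥ x) ≤ (1 - ε) * (s * (x ⬝ᵥ x))} ≤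
      2 * Real.exp (-(c * ε ^ 2 * k))
  upper : ∀ x : Fin m → ℝ, ∀ ε : ℝ, 0 ≤ ε → ε ≤ 1 →
    μ.real {ω | (1 + ε) * (s * (x ⬝ᵥ x)) < (P ω *ᵥ x) ⬝ᵥ (P ω *ᵥ x)} ≤
      2 * Real.exp (-(c * ε ^ 2 * k))

variable {Ω : Type*} [MeasurableSpace Ω] {μ : Measure Ω} {k m : ℕ}

lemma dotProduct_self_pos {x : Fin m → ℝ} (hx : x ≠ 0) : 0 < x ⬝ᵥ x :=
  lt_of_le_of_ne (Finset.sum_nonneg fun i _ => mul_self_nonneg (x i))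
    fun h => hx (dotProduct_self_eq_zero.mp h.symm)

lemma exists_eq_smul_unit {x : Fin m → ℝ} (hx : x ≠ 0) :
    ∃ (r : ℝ) (u : Fin m → ℝ), 0 < r ∧ u ⬝ᵥ u = 1 ∧ x = r • u := by
  have h := dotProduct_self_pos hx
  have hr : 0 < √(x ⬝ᵥ x) := Real.sqrt_pos.mpr h
  refine ⟨√(x ⬝ᵥ x), (√(x ⬝ᵥ x))⁻¹ • x, hr, ?_, ?_⟩
  · rw [smul_dotProduct, dotProduct_smul, smul_eq_mul, smul_eq_mul]
    field_simp
    rw [Real.sq_sqrt h.le]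
  · rw [smul_inv_smul₀ hr.ne']

/-- It suffices to check norm concentration on unit vectors. -/
lemma NormConcentrates.of_unit {P : Ω → Matrix (Fin k) (Fin m) ℝ} {s c : ℝ}
    (lower : ∀ u : Fin m → ℝ, u ⬝ᵥ u = 1 → ∀ ε : ℝ, 0 ≤ ε → ε ≤ 1 →
      μ.real {ω | (P ω *ᵥ u) ⬝ᵥ (P ω *ᵥ u) ≤ (1 - ε) * s} ≤ 2 * Real.exp (-(c * ε ^ 2 * k)))
    (upper : ∀ u : Fin m → ℝ, u ⬝ᵥ u = 1 → ∀ ε : ℝ, 0 ≤ ε → ε ≤ 1 →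
      μ.real {ω | (1 + ε) * s < (P ω *ᵥ u) ⬝ᵥ (P ω *ᵥ u)} ≤ 2 * Real.exp (-(c * ε ^ 2 * k))) :
    NormConcentrates μ P s c where
  lower x hx ε h0 h1 := by
    obtain ⟨r, u, hr, hu, rfl⟩ := exists_eq_smul_unit hx
    convert lower u hu ε h0 h1 using 4 with ω
    simp only [mulVec_smul, smul_dotProduct, dotProduct_smul, smul_eq_mul, hu]
    rw [show (1 - ε) * (s * (r * (r * 1))) = r * (r * ((1 - ε) * s)) by ring,
      mul_le_mul_iff_right₀ hr, mul_le_mul_iff_right₀ hr]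
  upper x ε h0 h1 := by
    by_cases hx : x = 0
    · simp [hx]
      positivity
    obtain ⟨r, u, hr, hu, rfl⟩ := exists_eq_smul_unit hx
    convert upper u hu ε h0 h1 using 4 with ω
    simp only [mulVec_smul, smul_dotProduct, dotProduct_smul, smul_eq_mul, hu]
    rw [show (1 + ε) * (s * (r * (r * 1))) = r * (r * ((1 + ε) * s)) by ring,
      mul_lt_mul_iff_right₀ hr, mul_lt_mul_iff_right₀ hr]

/-- Matrices with independent centred sub-Gaussian entries concentrate norms. -/
lemma HasIIDEntries.normConcentrates [IsProbabilityMeasure μ]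
    {P : Ω → Matrix (Fin k) (Fin m) ℝ} {ν : Measure ℝ} [IsProbabilityMeasure ν]
    (h : HasIIDEntries μ P ν) (hν : HasSubgaussianMGF id 1 ν) (h0 : ∫ x, x ∂ν = 0) {v : ℝ}
    (hv : ∫ x, x ^ 2 ∂ν = v) (hv0 : 1 / 3 ≤ v) (hv1 : v ≤ 1) :
    NormConcentrates μ P (v * k) (1 / 73728) := by
  have hsub := h.hasSubgaussianMGF hν
  have hind : ∀ i, iIndepFun (fun j ω => P ω i j) μ := fun i =>
    h.indep.precomp (g := fun j => (i, j)) fun _ _ hj => (Prod.ext_iff.mp hj).2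
  have hz : ∀ i j, ∫ ω, P ω i j ∂μ = 0 := fun i j => by
    rw [(h.entry_law i j).integral_eq, h0]
  have hq : ∀ i j, ∫ ω, P ω i j ^ 2 ∂μ = v := fun i j =>
    ((h.entry_law i j).integral_comp (f := fun x => x ^ 2) (by fun_prop)).trans hv
  have hform : ∀ (u : Fin m → ℝ) i ω, (P ω *ᵥ u) i = ∑ j, u j * P ω i j := fun u i ω => by
    simp [mulVec, dotProduct, mul_comm]
  have hY : ∀ u : Fin m → ℝ, iIndepFun (fun i ω => (P ω *ᵥ u) i) μ := fun u =>
    h.iIndepFun_rows.comp (fun _ r => r ⬝ᵥ u) fun _ => by unfold dotProduct; fun_prop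
  have hYsub : ∀ u : Fin m → ℝ, u ⬝ᵥ u = 1 → ∀ i,
      HasSubgaussianMGF (fun ω => (P ω *ᵥ u) i) 1 μ := fun u hu i => by
    simp only [hform]
    exact hasSubgaussianMGF_linearForm (hind i) (hsub i) hu
  have hYsq : ∀ u : Fin m → ℝ, u ⬝ᵥ u = 1 → ∀ i, ∫ ω, (P ω *ᵥ u) i ^ 2 ∂μ = v := fun u hu i => by
    simp only [hform]
    rw [integral_linearForm_sq (hind i) (fun j => (hsub i j).memLp 2) (hz i) (hq i), hu, mul_one]
  have hdot : ∀ (u : Fin m → ℝ) ω, (P ω *ᵥ u) ⬝ᵥ (P ω *ᵥ u) = ∑ i, (P ω *ᵥ u) i ^ 2 := fun u ω =>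
    Finset.sum_congr rfl fun i _ => (pow_two _).symm
  have hexp : ∀ ε : ℝ, Real.exp (-(ε ^ 2 * k / 73728)) ≤
      2 * Real.exp (-(1 / 73728 * ε ^ 2 * k)) := fun ε => by
    rw [show 1 / 73728 * ε ^ 2 * k = ε ^ 2 * k / 73728 by ring]
    linarith [Real.exp_pos (-(ε ^ 2 * k / 73728))]
  refine NormConcentrates.of_unit (fun u hu ε he0 he1 => ?_) (fun u hu ε he0 he1 => ?_)
  · simp only [hdot]
    exact (measureReal_sum_sq_le_le (hY u) (hYsub u hu) hv0 hv1 (hYsq u hu) he0 he1).trans (hexp ε)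
  · simp only [hdot]
    refine (measureReal_mono fun ω hω => ?_).trans ((measureReal_sum_sq_ge_le (hY u) (hYsub u hu)
      hv0 hv1 (hYsq u hu) he0 he1).trans (hexp ε))
    exact le_of_lt (Set.mem_ofPred_eq ▸ hω)

/-! ### A Gaussian vector under a fixed matrix with orthonormal rows -/

section Gaussian

/-- The standard Gaussian measure on coordinate vectors. -/
noncomputable abbrev stdGaussianPi (m : ℕ) : Measure (Fin m → ℝ) :=
  Measure.pi fun _ => gaussianReal 0 1

lemma iIndepFun_eval_stdGaussianPi :
    iIndepFun (fun (j : Fin m) (g : Fin m → ℝ) => g j) (stdGaussianPi m) :=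
  iIndepFun_pi (X := fun _ y => y) fun _ => aemeasurable_id

lemma hasLaw_eval_stdGaussianPi (j : Fin m) :
    HasLaw (fun g : Fin m → ℝ => g j) (gaussianReal 0 1) (stdGaussianPi m) :=
  (measurePreserving_eval (fun _ : Fin m => gaussianReal 0 1) j).hasLaw

lemma hasSubgaussianMGF_eval_stdGaussianPi (j : Fin m) :
    HasSubgaussianMGF (fun g : Fin m → ℝ => g j) 1 (stdGaussianPi m) := by
  refine HasSubgaussianMGF.of_map (X := id) (hasLaw_eval_stdGaussianPi j).aemeasurable ?_
  rw [(hasLaw_eval_stdGaussianPi j).map_eq]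
  exact hasSubgaussianMGF_id_gaussianReal

lemma integral_eval_stdGaussianPi (j : Fin m) : ∫ g, g j ∂(stdGaussianPi m) = 0 := by
  rw [(hasLaw_eval_stdGaussianPi j).integral_eq]
  simp

lemma integral_eval_sq_stdGaussianPi (j : Fin m) : ∫ g, g j ^ 2 ∂(stdGaussianPi m) = 1 :=
  ((hasLaw_eval_stdGaussianPi j).integral_comp (f := fun x => x ^ 2) (by fun_prop)).trans
    integral_sq_gaussianReal

variable {A : Matrix (Fin k) (Fin m) ℝ}

lemma row_dotProduct_row (hA : A * Aᵀ = 1) (i j : Fin k) :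
    A i ⬝ᵥ A j = if i = j then 1 else 0 := by
  have := congrFun (congrFun hA i) j
  rwa [mul_apply', one_apply] at this

/-- The image of a standard Gaussian vector under a matrix with orthonormal rows has independent
coordinates. -/
lemma iIndepFun_mulVec_stdGaussianPi (hA : A * Aᵀ = 1) :
    iIndepFun (fun i (g : Fin m → ℝ) => (A *ᵥ g) i) (stdGaussianPi m) := by
  have hg : HasGaussianLaw (fun (g : Fin m → ℝ) (j : Fin m) => g j) (stdGaussianPi m) :=
    iIndepFun_eval_stdGaussianPi.hasGaussianLaw fun j =>
      (hasLaw_eval_stdGaussianPi j).hasGaussianLaw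
  -- For jointly Gaussian coordinates uncorrelated means independent, and the covariances are the
  -- inner products of distinct rows.
  refine HasGaussianLaw.iIndepFun_of_covariance_eq_zero
    (hg.map_fun (LinearMap.toContinuousLinearMap (Matrix.toLin' A))) fun i j hij => ?_
  exact (covariance_linearForm iIndepFun_eval_stdGaussianPi
    (fun j => (hasSubgaussianMGF_eval_stdGaussianPi j).memLp 2) integral_eval_stdGaussianPi
    integral_eval_sq_stdGaussianPi (A i) (A j)).trans (by simp [row_dotProduct_row hA, hij])

lemma hasSubgaussianMGF_mulVec_stdGaussianPi (hA : A * Aᵀ = 1) (i : Fin k) :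
    HasSubgaussianMGF (fun g : Fin m → ℝ => (A *ᵥ g) i) 1 (stdGaussianPi m) :=
  hasSubgaussianMGF_linearForm iIndepFun_eval_stdGaussianPi
    hasSubgaussianMGF_eval_stdGaussianPi (by simp [row_dotProduct_row hA])

lemma integral_mulVec_sq_stdGaussianPi (hA : A * Aᵀ = 1) (i : Fin k) :
    ∫ g, (A *ᵥ g) i ^ 2 ∂(stdGaussianPi m) = 1 :=
  (integral_linearForm_sq iIndepFun_eval_stdGaussianPi
    (fun j => (hasSubgaussianMGF_eval_stdGaussianPi j).memLp 2) integral_eval_stdGaussianPi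
    integral_eval_sq_stdGaussianPi (A i)).trans (by simp [row_dotProduct_row hA])

lemma stdGaussianPi_norm_sq_ge_le (hA : A * Aᵀ = 1) {ε : ℝ} (h0 : 0 ≤ ε) (h1 : ε ≤ 1) :
    (stdGaussianPi m).real {g | (1 + ε) * k ≤ (A *ᵥ g) ⬝ᵥ (A *ᵥ g)} ≤
      Real.exp (-(ε ^ 2 * k / 73728)) := by
  simpa [dotProduct, pow_two] using measureReal_sum_sq_ge_le (iIndepFun_mulVec_stdGaussianPi hA)
    (hasSubgaussianMGF_mulVec_stdGaussianPi hA) (by norm_num) le_rfl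
    (integral_mulVec_sq_stdGaussianPi hA) h0 h1

lemma stdGaussianPi_norm_sq_le_le (hA : A * Aᵀ = 1) {ε : ℝ} (h0 : 0 ≤ ε) (h1 : ε ≤ 1) :
    (stdGaussianPi m).real {g | (A *ᵥ g) ⬝ᵥ (A *ᵥ g) ≤ (1 - ε) * k} ≤
      Real.exp (-(ε ^ 2 * k / 73728)) := by
  simpa [dotProduct, pow_two] using measureReal_sum_sq_le_le (iIndepFun_mulVec_stdGaussianPi hA)
    (hasSubgaussianMGF_mulVec_stdGaussianPi hA) (by norm_num) le_rfl
    (integral_mulVec_sq_stdGaussianPi hA) h0 h1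

lemma le_of_mul_transpose_eq_one (hA : A * Aᵀ = 1) : k ≤ m := by
  have h1 := rank_mul_le_left A Aᵀ
  have h2 := rank_le_width A
  rw [hA, rank_one, Fintype.card_fin] at h1
  omega

/-- Since k ≤ m, the tail of ‖g‖² is no larger than that of ‖Ag‖². Splitting the error into ε/4 for
each divides the rate by 16: 16 · 73728 = 1179648. -/
lemma two_exp_bound (hkm : k ≤ m) (ε : ℝ) :
    Real.exp (-((ε / 4) ^ 2 * k / 73728)) + Real.exp (-((ε / 4) ^ 2 * m / 73728)) ≤
      2 * Real.exp (-(1 / 1179648 * ε ^ 2 * k)) := by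
  have h1 : Real.exp (-((ε / 4) ^ 2 * m / 73728)) ≤ Real.exp (-((ε / 4) ^ 2 * k / 73728)) := by
    gcongr
  rw [show 1 / 1179648 * ε ^ 2 * k = (ε / 4) ^ 2 * k / 73728 by ring]
  linarith

lemma stdGaussianPi_ratio_le_le (hA : A * Aᵀ = 1) (hm : 0 < m) {ε : ℝ} (h0 : 0 ≤ ε) (h1 : ε ≤ 1) :
    (stdGaussianPi m).real {g | (A *ᵥ g) ⬝ᵥ (A *ᵥ g) ≤ (1 - ε) * (k / m * (g ⬝ᵥ g))} ≤
      2 * Real.exp (-(1 / 1179648 * ε ^ 2 * k)) := by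
  have hk := stdGaussianPi_norm_sq_le_le hA (ε := ε / 4) (by linarith) (by linarith)
  have hm' := stdGaussianPi_norm_sq_ge_le (A := (1 : Matrix (Fin m) (Fin m) ℝ)) (by simp)
    (ε := ε / 4) (by linarith) (by linarith)
  simp only [one_mulVec] at hm'
  refine le_trans ((measureReal_mono fun g hg => ?_).trans (measureReal_union_le _ _))
    ((add_le_add hk hm').trans (two_exp_bound (le_of_mul_transpose_eq_one hA) ε))
  rw [Set.mem_union, Set.mem_ofPred_eq, Set.mem_ofPred_eq]
  rw [Set.mem_ofPred_eq] at hg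
  by_contra! hcon
  have hm0 : (0 : ℝ) < m := by exact_mod_cast hm
  have h2 : (k : ℝ) / m * (g ⬝ᵥ g) ≤ (1 + ε / 4) * k := by
    rw [div_mul_eq_mul_div, div_le_iff₀ hm0]
    nlinarith [hcon.2, (Nat.cast_nonneg k : (0 : ℝ) ≤ k)]
  have h3 : (1 - ε) * (k / m * (g ⬝ᵥ g)) ≤ (1 - ε) * ((1 + ε / 4) * k) := by gcongr
  have h4 : (1 - ε) * (1 + ε / 4) ≤ 1 - ε / 4 := by nlinarith
  have h5 : (1 - ε) * (1 + ε / 4) * k ≤ (1 - ε / 4) * k := by gcongr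
  linarith [hcon.1]

lemma stdGaussianPi_ratio_gt_le (hA : A * Aᵀ = 1) (hm : 0 < m) {ε : ℝ} (h0 : 0 ≤ ε) (h1 : ε ≤ 1) :
    (stdGaussianPi m).real {g | (1 + ε) * (k / m * (g ⬝ᵥ g)) < (A *ᵥ g) ⬝ᵥ (A *ᵥ g)} ≤
      2 * Real.exp (-(1 / 1179648 * ε ^ 2 * k)) := by
  have hk := stdGaussianPi_norm_sq_ge_le hA (ε := ε / 4) (by linarith) (by linarith)
  have hm' := stdGaussianPi_norm_sq_le_le (A := (1 : Matrix (Fin m) (Fin m) ℝ)) (by simp)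
    (ε := ε / 4) (by linarith) (by linarith)
  simp only [one_mulVec] at hm'
  refine le_trans ((measureReal_mono fun g hg => ?_).trans (measureReal_union_le _ _))
    ((add_le_add hk hm').trans (two_exp_bound (le_of_mul_transpose_eq_one hA) ε))
  rw [Set.mem_union, Set.mem_ofPred_eq, Set.mem_ofPred_eq]
  rw [Set.mem_ofPred_eq] at hg
  by_contra! hcon
  have hm0 : (0 : ℝ) < m := by exact_mod_cast hm
  have h2 : (1 - ε / 4) * k ≤ (k : ℝ) / m * (g ⬝ᵥ g) := by
    rw [div_mul_eq_mul_div, le_div_iff₀ hm0]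
    nlinarith [hcon.2, (Nat.cast_nonneg k : (0 : ℝ) ≤ k)]
  have h3 : (1 + ε) * ((1 - ε / 4) * k) ≤ (1 + ε) * (k / m * (g ⬝ᵥ g)) := by gcongr
  have h4 : 1 + ε / 4 ≤ (1 + ε) * (1 - ε / 4) := by nlinarith
  have h5 : (1 + ε / 4) * k ≤ (1 + ε) * (1 - ε / 4) * k := by gcongr
  linarith [hcon.1]

end Gaussian

end Concentration

/-! ### Uniformly random subspaces: exchanging the fixed vector for a Gaussian one -/

section Projection

/-- Two vectors of equal length are exchanged by an orthogonal matrix. -/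
lemma exists_orthogonal_transpose_mulVec_eq {m : ℕ} {x y : Fin m → ℝ} (h : x ⬝ᵥ x = y ⬝ᵥ y) :
    ∃ Q ∈ Matrix.orthogonalGroup (Fin m) ℝ, Qᵀ *ᵥ x = y := by
  by_cases hz : x - y = 0
  · exact ⟨1, one_mem _, by simpa using sub_eq_zero.mp hz⟩
  have hzz : 0 < (x - y) ⬝ᵥ (x - y) := dotProduct_self_pos hz
  have hzx : (x - y) ⬝ᵥ x = (x - y) ⬝ᵥ (x - y) / 2 := by
    simp only [sub_dotProduct, dotProduct_sub]
    rw [dotProduct_comm y x]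
    linarith
  have hy : y = x - (x - y) := (sub_sub_cancel x y).symm
  rw [hy]
  generalize x - y = z at hzz hzx
  -- The witness is the Householder reflection in the hyperplane orthogonal to z = x - y, which is
  -- symmetric.
  have hT : (1 - (2 / (z ⬝ᵥ z)) • vecMulVec z z)ᵀ = 1 - (2 / (z ⬝ᵥ z)) • vecMulVec z z := by
    simp [transpose_vecMulVec]
  refine ⟨1 - (2 / (z ⬝ᵥ z)) • vecMulVec z z, ?_, ?_⟩
  · rw [mem_orthogonalGroup_iff, hT]
    simp only [sub_mul, mul_sub, one_mul, mul_one, smul_mul_assoc, mul_smul_comm,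
      vecMulVec_mul_vecMulVec, vecMulVec_smul, smul_smul]
    rw [div_mul_cancel₀ _ hzz.ne']
    module
  · rw [hT, sub_mulVec, one_mulVec, smul_mulVec, vecMulVec_mulVec, hzx, op_smul_eq_smul, smul_smul]
    field_simp
    simp

variable {Ω : Type*} [MeasurableSpace Ω] {μ : Measure Ω} {k m : ℕ}
  {P : Ω → Matrix (Fin k) (Fin m) ℝ}

lemma mulVec_dotProduct_self (A : Matrix (Fin k) (Fin m) ℝ) (x : Fin m → ℝ) :
    (A *ᵥ x) ⬝ᵥ (A *ᵥ x) = x ⬝ᵥ ((Aᵀ * A) *ᵥ x) := by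
  rw [← mulVec_mulVec, dotProduct_mulVec x, vecMul_transpose]

/-- The law of `‖P x‖ ^ 2` depends only on the length of `x`. -/
lemma IsRandomOrthogonalProjection.measure_norm_sq_eq (h : IsRandomOrthogonalProjection μ P)
    {x y : Fin m → ℝ} (hxy : x ⬝ᵥ x = y ⬝ᵥ y) {S : Set ℝ} (hS : MeasurableSet S) :
    μ {ω | (P ω *ᵥ x) ⬝ᵥ (P ω *ᵥ x) ∈ S} = μ {ω | (P ω *ᵥ y) ⬝ᵥ (P ω *ᵥ y) ∈ S} := by
  obtain ⟨Q, hQ, hQx⟩ := exists_orthogonal_transpose_mulVec_eq hxy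
  have hid := h.uniform Q hQ
  -- Invariance is known only for the law of PᵀP, which suffices because ‖Px‖² = xᵀ(PᵀP)x.
  have hf : Measurable fun M : Fin m × Fin m → ℝ => ∑ i, x i * ∑ j, M (i, j) * x j := by fun_prop
  have h1 := (hid.comp hf).measure_mem_eq hS
  have h2 : ∀ ω, ∑ i, x i * ∑ j, (Q * ((P ω)ᵀ * P ω) * Qᵀ) i j * x j =
      (P ω *ᵥ y) ⬝ᵥ (P ω *ᵥ y) := by
    intro ω
    rw [mulVec_dotProduct_self]
    change x ⬝ᵥ ((Q * ((P ω)ᵀ * P ω) * Qᵀ) *ᵥ x) = _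
    rw [← mulVec_mulVec, hQx, ← mulVec_mulVec, dotProduct_mulVec, ← mulVec_transpose, hQx]
  have h3 : ∀ ω, ∑ i, x i * ∑ j, ((P ω)ᵀ * P ω) i j * x j = (P ω *ᵥ x) ⬝ᵥ (P ω *ᵥ x) := by
    intro ω
    rw [mulVec_dotProduct_self]
    rfl
  simp only [Function.comp_def, Set.preimage, h2, h3] at h1
  exact h1.symm

lemma aemeasurable_norm_sq (hP : ∀ i j, AEMeasurable (fun ω => P ω i j) μ) [SFinite μ] :
    AEMeasurable (fun q : Ω × (Fin m → ℝ) => (P q.1 *ᵥ q.2) ⬝ᵥ (P q.1 *ᵥ q.2))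
      (μ.prod (stdGaussianPi m)) := by
  have h1 : ∀ i j, AEMeasurable (fun q : Ω × (Fin m → ℝ) => P q.1 i j)
      (μ.prod (stdGaussianPi m)) := fun i j => (hP i j).comp_fst
  have h2 : ∀ i, AEMeasurable (fun q : Ω × (Fin m → ℝ) => (P q.1 *ᵥ q.2) i)
      (μ.prod (stdGaussianPi m)) := fun i => by
    unfold mulVec dotProduct
    fun_prop
  exact Finset.aemeasurable_fun_sum _ fun i _ => (h2 i).mul (h2 i)

/-- Averaging over a Gaussian vector: if the section measures are constant on one side and bounded
on the other, the constant satisfies the bound. -/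
lemma le_of_sections [IsProbabilityMeasure μ] {γ : Measure (Fin m → ℝ)} [IsProbabilityMeasure γ]
    {B : Set (Ω × (Fin m → ℝ))} (hB : NullMeasurableSet B (μ.prod γ)) {p C : ℝ≥0∞}
    (hp : ∀ᵐ g ∂γ, μ {ω | (ω, g) ∈ B} = p) (hC : ∀ᵐ ω ∂μ, γ {g | (ω, g) ∈ B} ≤ C) :
    p ≤ C := by
  -- Almost all sections of B, in either direction, agree almost everywhere with those of the
  -- measurable set B', to which Tonelli applies.
  obtain ⟨B', hB', hBB'⟩ := hB
  have h1 : ∀ᵐ ω ∂μ, ∀ᵐ g ∂γ, (ω, g) ∈ B ↔ (ω, g) ∈ B' :=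
    Measure.ae_ae_of_ae_prod hBB'.mem_iff
  have h2 : ∀ᵐ g ∂γ, ∀ᵐ ω ∂μ, (ω, g) ∈ B ↔ (ω, g) ∈ B' :=
    Measure.ae_ae_of_ae_prod (Measure.measurePreserving_swap.quasiMeasurePreserving.ae
      hBB'.mem_iff)
  have h1' : ∫⁻ ω, γ {g | (ω, g) ∈ B} ∂μ = ∫⁻ ω, γ {g | (ω, g) ∈ B'} ∂μ :=
    lintegral_congr_ae (h1.mono fun ω hω => measure_congr (Filter.eventuallyEq_set.mpr hω))
  have h2' : ∫⁻ g, μ {ω | (ω, g) ∈ B} ∂γ = ∫⁻ g, μ {ω | (ω, g) ∈ B'} ∂γ :=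
    lintegral_congr_ae (h2.mono fun g hg => measure_congr (Filter.eventuallyEq_set.mpr hg))
  have hl : ∫⁻ g, μ {ω | (ω, g) ∈ B} ∂γ = ∫⁻ ω, γ {g | (ω, g) ∈ B} ∂μ := by
    rw [h1', h2']
    exact (Measure.prod_apply_symm hB').symm.trans (Measure.prod_apply hB')
  calc p = ∫⁻ _, p ∂γ := by simp
    _ = ∫⁻ g, μ {ω | (ω, g) ∈ B} ∂γ := (lintegral_congr_ae hp).symm
    _ = ∫⁻ ω, γ {g | (ω, g) ∈ B} ∂μ := hl
    _ ≤ ∫⁻ _, C ∂μ := lintegral_mono_ae hC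
    _ = C := by simp

/-- Random orthogonal projections concentrate norms. -/
lemma IsRandomOrthogonalProjection.normConcentrates [IsProbabilityMeasure μ]
    (h : IsRandomOrthogonalProjection μ P) :
    NormConcentrates μ P (k / m) (1 / 1179648) := by
  have hA := aemeasurable_norm_sq h.aemeasurable_entry
  have hg0 : ∀ u : Fin m → ℝ, u ⬝ᵥ u = 1 → 0 < m ∧ ∀ᵐ g ∂(stdGaussianPi m), g ≠ 0 := by
    intro u hu
    have hm : 0 < m := by
      rcases Nat.eq_zero_or_pos m with rfl | hm
      · simp at hu
      · exact hm
    have : Nonempty (Fin m) := ⟨⟨0, hm⟩⟩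
    have : NullSingletonClass (gaussianReal 0 1) := nullSingletonClass_gaussianReal one_ne_zero
    exact ⟨hm, by simp [ae_iff]⟩
  -- Each g ≠ 0 is a multiple of a unit vector w, and ‖Pw‖² has the law of ‖Pu‖²; hence the sections
  -- over g have constant probability.
  have key : ∀ (u g : Fin m → ℝ), u ⬝ᵥ u = 1 → g ≠ 0 → ∃ w : Fin m → ℝ, u ⬝ᵥ u = w ⬝ᵥ w ∧
      0 < g ⬝ᵥ g ∧ ∀ ω, (P ω *ᵥ g) ⬝ᵥ (P ω *ᵥ g) = (g ⬝ᵥ g) * ((P ω *ᵥ w) ⬝ᵥ (P ω *ᵥ w)) := by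
    intro u g hu hg
    obtain ⟨r, w, hr, hw, rfl⟩ := exists_eq_smul_unit hg
    refine ⟨w, by rw [hu, hw], dotProduct_self_pos hg, fun ω => ?_⟩
    simp only [mulVec_smul, smul_dotProduct, dotProduct_smul, smul_eq_mul, hw]
    ring
  refine NormConcentrates.of_unit (fun u hu ε he0 he1 => ?_) (fun u hu ε he0 he1 => ?_)
  · obtain ⟨hm, hae⟩ := hg0 u hu
    refine ENNReal.toReal_le_of_le_ofReal (by positivity) (le_of_sections
      (nullMeasurableSet_le hA
        (g := fun q => (1 - ε) * (k / m * (q.2 ⬝ᵥ q.2))) (by unfold dotProduct; fun_prop))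
      (γ := stdGaussianPi m) ?_ ?_)
    · filter_upwards [hae] with g hg
      obtain ⟨w, huw, hpos, hw⟩ := key u g hu hg
      have := h.measure_norm_sq_eq huw (measurableSet_Iic (a := (1 - ε) * (k / m)))
      simp only [Set.mem_Iic] at this
      rw [this]
      congr 1 with ω
      simp only [Set.mem_ofPred_eq, hw]
      rw [show (1 - ε) * (k / m * (g ⬝ᵥ g)) = (g ⬝ᵥ g) * ((1 - ε) * (k / m)) by ring,
        mul_le_mul_iff_right₀ hpos]
    · filter_upwards [h.orthonormal_rows] with ω hω
      refine ENNReal.le_ofReal_iff_toReal_le (measure_ne_top _ _) (by positivity) |>.mpr ?_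
      exact stdGaussianPi_ratio_le_le hω hm he0 he1
  · obtain ⟨hm, hae⟩ := hg0 u hu
    refine ENNReal.toReal_le_of_le_ofReal (by positivity) (le_of_sections
      (nullMeasurableSet_lt
        (f := fun q => (1 + ε) * (k / m * (q.2 ⬝ᵥ q.2))) (by unfold dotProduct; fun_prop) hA)
      (γ := stdGaussianPi m) ?_ ?_)
    · filter_upwards [hae] with g hg
      obtain ⟨w, huw, hpos, hw⟩ := key u g hu hg
      have := h.measure_norm_sq_eq huw (measurableSet_Ioi (a := (1 + ε) * (k / m)))
      simp only [Set.mem_Ioi] at this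
      rw [this]
      congr 1 with ω
      simp only [Set.mem_ofPred_eq, hw]
      rw [show (1 + ε) * (k / m * (g ⬝ᵥ g)) = (g ⬝ᵥ g) * ((1 + ε) * (k / m)) by ring,
        mul_lt_mul_iff_right₀ hpos]
    · filter_upwards [h.orthonormal_rows] with ω hω
      refine ENNReal.le_ofReal_iff_toReal_le (measure_ne_top _ _) (by positivity) |>.mpr ?_
      exact stdGaussianPi_ratio_gt_le hω hm he0 he1

end Projection

/-! ### Preserved signs of inner products and separation of b from C -/

section Separation

variable {Ω : Type*} [MeasurableSpace Ω] {μ : Measure Ω} {k m : ℕ}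
  {P : Ω → Matrix (Fin k) (Fin m) ℝ} {s c : ℝ}

lemma NormConcentrates.mono {c' : ℝ} (h : NormConcentrates μ P s c) (hc : c' ≤ c) :
    NormConcentrates μ P s c' := by
  have hexp : ∀ ε : ℝ, 2 * Real.exp (-(c * ε ^ 2 * k)) ≤ 2 * Real.exp (-(c' * ε ^ 2 * k)) :=
    fun ε => by gcongr
  exact ⟨fun x hx ε h0 h1 => (h.lower x hx ε h0 h1).trans (hexp ε),
    fun x ε h0 h1 => (h.upper x ε h0 h1).trans (hexp ε)⟩

/-- The scale s depends on the kind of matrix, but the rate does not: the one for random subspaces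
is the weakest. -/
lemma IsProjectionMatrix.exists_normConcentrates [IsProbabilityMeasure μ]
    (h : IsProjectionMatrix μ P) (hk : 0 < k) (hm : 0 < m) :
    ∃ s : ℝ, 0 < s ∧ NormConcentrates μ P s (1 / 1179648) := by
  have hk' : (0 : ℝ) < k := by exact_mod_cast hk
  have hm' : (0 : ℝ) < m := by exact_mod_cast hm
  cases h with
  | orthogonal h => exact ⟨k / m, by positivity, h.normConcentrates⟩
  | gaussian h =>
    exact ⟨1 * k, by positivity, (h.normConcentrates hasSubgaussianMGF_id_gaussianReal (by simp)
      integral_sq_gaussianReal (by norm_num) le_rfl).mono (by norm_num)⟩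
  | sign h =>
    exact ⟨1 * k, by positivity, (h.normConcentrates hasSubgaussianMGF_id_signLaw
      (by simp [integral_signLaw]) (by simp [integral_signLaw]) (by norm_num) le_rfl).mono
      (by norm_num)⟩
  | sparseSign h =>
    exact ⟨1 / 3 * k, by positivity, (h.normConcentrates hasSubgaussianMGF_id_sparseSignLaw
      (by simp [integral_sparseSignLaw]) (by rw [integral_sparseSignLaw]; norm_num) le_rfl
      (by norm_num)).mono (by norm_num)⟩

/-- Off two tail events, polarization gives 4⟨Pu, Pw⟩ > s((1 - ε)(2 + 2⟨u, w⟩) - (1 + ε)(2 - 2⟨u,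
w⟩)) = 4s(⟨u, w⟩ - ε) > 0. -/
lemma NormConcentrates.measureReal_dotProduct_nonpos_le_of_unit [IsProbabilityMeasure μ]
    (h : NormConcentrates μ P s c) (hs : 0 < s) {u w : Fin m → ℝ} (hu : u ⬝ᵥ u = 1)
    (hw : w ⬝ᵥ w = 1) {ε : ℝ} (h0 : 0 ≤ ε) (h1 : ε ≤ 1) (hε : ε < u ⬝ᵥ w) :
    μ.real {ω | (P ω *ᵥ u) ⬝ᵥ (P ω *ᵥ w) ≤ 0} ≤ 4 * Real.exp (-(c * ε ^ 2 * k)) := by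
  have hadd : (u + w) ⬝ᵥ (u + w) = 2 + 2 * (u ⬝ᵥ w) := by
    simp only [add_dotProduct, dotProduct_add, hu, hw, dotProduct_comm w u]
    ring
  have hsub : (u - w) ⬝ᵥ (u - w) = 2 - 2 * (u ⬝ᵥ w) := by
    simp only [sub_dotProduct, dotProduct_sub, hu, hw, dotProduct_comm w u]
    ring
  -- The non-strict lower tail event is certain at the zero vector, so u + w must be nonzero. The
  -- difference u - w may vanish, which the strict upper tail allows.
  have hne : u + w ≠ 0 := by
    intro h
    rw [h, zero_dotProduct] at hadd
    linarith
  have hl := h.lower (u + w) hne ε h0 h1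
  have hup := h.upper (u - w) ε h0 h1
  rw [hadd] at hl
  rw [hsub] at hup
  refine ((measureReal_mono fun ω hω => ?_).trans (measureReal_union_le _ _)).trans
    ((add_le_add hl hup).trans (by linarith))
  rw [Set.mem_union, Set.mem_ofPred_eq, Set.mem_ofPred_eq]
  rw [Set.mem_ofPred_eq] at hω
  by_contra! hcon
  obtain ⟨c1, c2⟩ := hcon
  simp only [mulVec_add, mulVec_sub, add_dotProduct, dotProduct_add, sub_dotProduct,
    dotProduct_sub, dotProduct_comm (P ω *ᵥ w) (P ω *ᵥ u)] at c1 c2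
  nlinarith [mul_pos hs (sub_pos.mpr hε)]

/-- Random matrices that concentrate norms preserve the positivity of inner products. -/
lemma NormConcentrates.measureReal_dotProduct_nonpos_le [IsProbabilityMeasure μ]
    (h : NormConcentrates μ P s c) (hs : 0 < s) {u w : Fin m → ℝ} {ε : ℝ} (h0 : 0 ≤ ε)
    (h1 : ε ≤ 1) (huw : 0 < u ⬝ᵥ w) (hε : ε ^ 2 * (u ⬝ᵥ u) * (w ⬝ᵥ w) < (u ⬝ᵥ w) ^ 2) :
    μ.real {ω | (P ω *ᵥ u) ⬝ᵥ (P ω *ᵥ w) ≤ 0} ≤ 4 * Real.exp (-(c * ε ^ 2 * k)) := by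
  obtain ⟨r, u', hr, hu', rfl⟩ := exists_eq_smul_unit (x := u) (by rintro rfl; simp at huw)
  obtain ⟨t, w', ht, hw', rfl⟩ := exists_eq_smul_unit (x := w) (by rintro rfl; simp at huw)
  simp only [smul_dotProduct, dotProduct_smul, smul_eq_mul, hu', hw'] at huw hε
  have hpos : 0 < u' ⬝ᵥ w' := by
    rw [mul_pos_iff_of_pos_left ht, mul_pos_iff_of_pos_left hr] at huw
    exact huw
  have hlt : ε < u' ⬝ᵥ w' := by
    refine lt_of_pow_lt_pow_left₀ 2 hpos.le ?_
    have : 0 < (r * t) ^ 2 := by positivity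
    refine lt_of_mul_lt_mul_left ?_ this.le
    linarith
  convert h.measureReal_dotProduct_nonpos_le_of_unit hs hu' hw' h0 h1 hlt using 4 with ω
  simp only [mulVec_smul, smul_dotProduct, dotProduct_smul, smul_eq_mul]
  constructor
  · intro hle
    by_contra! hcon
    have : 0 < t * (r * ((P ω *ᵥ u') ⬝ᵥ (P ω *ᵥ w'))) := by positivity
    linarith
  · intro hle
    exact mul_nonpos_of_nonneg_of_nonpos ht.le (mul_nonpos_of_nonneg_of_nonpos hr.le hle)

/-- If the direction `w` separates `b` from the points `a i` after applying `A`, then the image of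
`b` lies outside the image of the convex hull. -/
lemma scaledMap_notMem_image {n : ℕ} (hk : 0 < k) (A : Matrix (Fin k) (Fin m) ℝ)
    (a : Fin n → EuclideanSpace ℝ (Fin m)) (b : EuclideanSpace ℝ (Fin m)) (w : Fin m → ℝ)
    (h : ∀ i, 0 < (A *ᵥ (a i - b).ofLp) ⬝ᵥ (A *ᵥ w)) :
    scaledMap A b ∉ scaledMap A '' convexHull ℝ (Set.range a) := by
  rintro ⟨x, hx, hxb⟩
  have hk' : (0 : ℝ) < k := by exact_mod_cast hk
  have hne : √(1 / (k : ℝ)) ≠ 0 := (Real.sqrt_pos.mpr (by positivity)).ne'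
  have hAx : A *ᵥ x.ofLp = A *ᵥ b.ofLp := by
    rw [scaledMap, LinearMap.smul_apply, LinearMap.smul_apply] at hxb
    exact congrArg WithLp.ofLp (smul_right_injective _ hne hxb)
  have hlin : IsLinearMap ℝ fun y : EuclideanSpace ℝ (Fin m) => (A *ᵥ y.ofLp) ⬝ᵥ (A *ᵥ w) :=
    ⟨fun y z => by simp [mulVec_add, add_dotProduct], fun r y => by
      simp [mulVec_smul, smul_dotProduct]⟩
  have hsub := convexHull_min (s := Set.range a) ?_
    (convex_halfSpace_gt hlin ((A *ᵥ b.ofLp) ⬝ᵥ (A *ᵥ w)))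
  · have := hsub hx
    rw [Set.mem_ofPred_eq, hAx] at this
    exact lt_irrefl _ this
  · rintro _ ⟨i, rfl⟩
    have := h i
    rw [WithLp.ofLp_sub, mulVec_sub, sub_dotProduct] at this
    exact sub_pos.mp this

/-- The projection inequality ⟨b - q, x - q⟩ ≤ 0 is rewritten with b as origin. -/
lemma sq_dist_le_inner_of_isLeast {E : Type*} [NormedAddCommGroup E] [InnerProductSpace ℝ E]
    {K : Set E} (hK : Convex ℝ K) {b q x : E} (hq : q ∈ K)
    (hmin : ∀ y ∈ K, ‖b - q‖ ≤ ‖b - y‖) (hx : x ∈ K) :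
    ‖b - q‖ ^ 2 ≤ inner ℝ (x - b) (q - b) := by
  have hinf : ‖b - q‖ = ⨅ y : K, ‖b - y‖ := by
    have : Nonempty K := ⟨⟨q, hq⟩⟩
    refine le_antisymm (le_ciInf fun y => hmin y y.2) ?_
    exact ciInf_le ⟨0, by rintro _ ⟨y, rfl⟩; exact norm_nonneg _⟩ (⟨q, hq⟩ : K)
  have h := (norm_eq_iInf_iff_real_inner_le_zero hK hq).mp hinf x hx
  have e : inner ℝ (x - b) (q - b) = ‖b - q‖ ^ 2 - inner ℝ (b - q) (x - q) := by
    rw [← real_inner_self_eq_norm_sq, ← inner_sub_right, real_inner_comm,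
      ← neg_sub b q, inner_neg_left, ← inner_neg_right]
    congr 1
    abel
  linarith

lemma inner_eq_ofLp_dotProduct (x y : EuclideanSpace ℝ (Fin m)) :
    inner ℝ x y = x.ofLp ⬝ᵥ y.ofLp := by
  simp [PiLp.inner_apply, dotProduct, mul_comm]

/-- The trivial bound `1` absorbs constant factors in a union bound. -/
lemma one_sub_le_of_failure_le {n : ℕ} (hn : 1 ≤ n) {p y z : ℝ} (hp1 : p ≤ 1)
    (hy : 0 ≤ y) (hp : p ≤ n * (4 * y ^ 2)) (hyz : y ≤ z) :
    1 - 2 * (n : ℝ) ^ 2 * z ≤ 1 - p := by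
  have hn' : (1 : ℝ) ≤ n := by exact_mod_cast hn
  suffices p ≤ 2 * n ^ 2 * y by
    have : 2 * (n : ℝ) ^ 2 * y ≤ 2 * n ^ 2 * z := by gcongr
    linarith
  have h2 : 2 * (n : ℝ) * y ≤ 2 * n ^ 2 * y := by
    gcongr
    exact le_self_pow₀ hn' two_ne_zero
  refine le_trans ?_ h2
  -- If 2ny < 1, then also 2y < 1, so 4ny² = (2ny)(2y) ≤ 2ny.
  rcases le_or_gt 1 (2 * n * y) with h | h
  · linarith
  · nlinarith

end Separation

end RandomProjection

/-! ### Union bound over the points a_i -/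

open RandomProjection Matrix

theorem mainTheorem2 :
    ∃ c : ℝ, 0 < c ∧
      ∀ (m n k : ℕ) (_ : 1 ≤ n)
        (Ω : Type*) [MeasurableSpace Ω] (μ : Measure Ω) [IsProbabilityMeasure μ]
        (P : Ω → Matrix (Fin k) (Fin m) ℝ) (_ : RandomProjection.IsProjectionMatrix μ P)
        (a : Fin n → EuclideanSpace ℝ (Fin m)) (b : EuclideanSpace ℝ (Fin m))
        (_ : b ∉ convexHull ℝ (Set.range a)) (d D ε : ℝ)
        (_ : IsLeast ((fun x => ‖b - x‖) '' convexHull ℝ (Set.range a)) d)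
        (_ : IsGreatest (Set.range fun i => ‖b - a i‖) D)
        (_ : 0 < ε) (_ : ε < d ^ 2 / D ^ 2),
        1 - 2 * (n : ℝ) ^ 2 * Real.exp (-c * (ε ^ 2 - ε ^ 3) * k) ≤
          μ.real {ω | RandomProjection.scaledMap (P ω) b ∉
            RandomProjection.scaledMap (P ω) '' convexHull ℝ (Set.range a)} := by
  -- Half the rate 1/1179648, so that each single-point failure bound is 4y² with y at the new rate.
  refine ⟨1 / 2359296, by norm_num, ?_⟩
  intro m n k hn Ω _ μ _ P hP a b hb d D ε hd hD hε0 hε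
  have hn' : (1 : ℝ) ≤ n := by exact_mod_cast hn
  rcases Nat.eq_zero_or_pos k with rfl | hk
  · refine le_trans ?_ measureReal_nonneg
    simp only [Nat.cast_zero, mul_zero, Real.exp_zero, mul_one]
    nlinarith
  obtain ⟨⟨q, hq, hqd⟩, hmin⟩ := hd
  dsimp only at hqd
  have hqmin : ∀ y ∈ convexHull ℝ (Set.range a), ‖b - q‖ ≤ ‖b - y‖ := fun y hy =>
    hqd ▸ hmin ⟨y, hy, rfl⟩
  have hdpos : 0 < d := by
    rw [← hqd, norm_pos_iff, sub_ne_zero]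
    rintro rfl
    exact hb hq
  have haD : ∀ i, ‖b - a i‖ ≤ D := fun i => hD.2 ⟨i, rfl⟩
  have had : ∀ i, d ≤ ‖b - a i‖ := fun i =>
    hmin ⟨a i, subset_convexHull ℝ _ ⟨i, rfl⟩, rfl⟩
  have hdD : d ≤ D := (had ⟨0, hn⟩).trans (haD ⟨0, hn⟩)
  have hDpos : 0 < D := hdpos.trans_le hdD
  have hε1 : ε ≤ 1 := hε.le.trans (div_le_one_of_le₀ (by gcongr) (by positivity))
  have hεD : ε * D ^ 2 < d ^ 2 := (lt_div_iff₀ (by positivity)).mp hε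
  have hm : 0 < m := by
    rcases Nat.eq_zero_or_pos m with rfl | hm
    · exact absurd (Subsingleton.elim q b ▸ hq) hb
    · exact hm
  obtain ⟨s, hs, hconc⟩ := hP.exists_normConcentrates hk hm
  set w : Fin m → ℝ := (q - b).ofLp with hw
  have hww : w ⬝ᵥ w = d ^ 2 := by
    rw [hw, ← inner_eq_ofLp_dotProduct, real_inner_self_eq_norm_sq, norm_sub_rev, hqd]
  have hbad : ∀ i, μ.real {ω | (P ω *ᵥ (a i - b).ofLp) ⬝ᵥ (P ω *ᵥ w) ≤ 0} ≤
      4 * Real.exp (-(1 / 1179648 * ε ^ 2 * k)) := by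
    intro i
    have hinner : d ^ 2 ≤ (a i - b).ofLp ⬝ᵥ w := by
      rw [hw, ← inner_eq_ofLp_dotProduct, ← hqd]
      exact sq_dist_le_inner_of_isLeast (convex_convexHull ℝ _) hq hqmin
        (subset_convexHull ℝ _ ⟨i, rfl⟩)
    have huu : (a i - b).ofLp ⬝ᵥ (a i - b).ofLp ≤ D ^ 2 := by
      rw [← inner_eq_ofLp_dotProduct, real_inner_self_eq_norm_sq, norm_sub_rev]
      exact pow_le_pow_left₀ (norm_nonneg _) (haD i) 2
    refine hconc.measureReal_dotProduct_nonpos_le hs hε0.le hε1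
      (lt_of_lt_of_le (by positivity) hinner) ?_
    -- The cosine is at least d/D ≥ d²/D² > ε; in squared form, ε² ≤ ε already suffices.
    calc ε ^ 2 * ((a i - b).ofLp ⬝ᵥ (a i - b).ofLp) * (w ⬝ᵥ w)
        ≤ ε ^ 2 * D ^ 2 * d ^ 2 := by rw [hww]; gcongr
      _ ≤ ε * D ^ 2 * d ^ 2 := by
          gcongr
          nlinarith
      _ < d ^ 2 * d ^ 2 := by gcongr
      _ = (d ^ 2) ^ 2 := by ring
      _ ≤ ((a i - b).ofLp ⬝ᵥ w) ^ 2 := by gcongr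
  set G := {ω | scaledMap (P ω) b ∉ scaledMap (P ω) '' convexHull ℝ (Set.range a)} with hG
  set B := ⋃ i, {ω | (P ω *ᵥ (a i - b).ofLp) ⬝ᵥ (P ω *ᵥ w) ≤ 0} with hB
  have hBle : μ.real B ≤ n * (4 * Real.exp (-(1 / 2359296 * ε ^ 2 * k)) ^ 2) := by
    refine (measureReal_iUnion_fintype_le _).trans ((Finset.sum_le_sum fun i _ => hbad i).trans ?_)
    rw [Finset.sum_const, Finset.card_univ, Fintype.card_fin, nsmul_eq_mul, ← Real.exp_nat_mul]
    refine le_of_eq ?_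
    congr 3
    push_cast
    ring
  have hcover : G ∪ B = Set.univ := by
    refine Set.eq_univ_of_forall fun ω => or_iff_not_imp_right.mpr fun hω => ?_
    refine scaledMap_notMem_image hk (P ω) a b w fun i => ?_
    by_contra! hle
    exact hω (Set.mem_iUnion.mpr ⟨i, hle⟩)
  -- Subadditivity on the cover G ∪ B avoids any measurability of G.
  have hGB : 1 - μ.real B ≤ μ.real G := by
    have := measureReal_union_le (μ := μ) G B
    rw [hcover, probReal_univ] at this
    linarith
  refine le_trans (one_sub_le_of_failure_le hn measureReal_le_one (Real.exp_pos _).le hBle ?_) hGB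
  gcongr
  have : 0 ≤ ε ^ 3 * k := by positivity
  linarith
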